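/- Let $M$ be a smooth manifold of dimension $n$, $\nabla$ a connection on $TM$ and $g$ a pseudo-Riemannian metric on $M$. Suppose that $(M,\nabla,g)$ is a parabolic sphere, that is, there are a smooth immersion $\varphi:M\to\mathbf R^{n+1}$ and a smooth vector field $\xi:M\to\mathbf R^{n+1}$ along $\varphi$, transversal to $\varphi$, such that (a) $\partial_X(d\varphi\, Y)=d\varphi(\nabla_XY)+g(X,Y)\,\xi$ for all vector fields $X,Y$ (so $\nabla$ and $g$ are induced by $\varphi$ and $\xi$); (b) the induced volume form $\theta=\det(\xi,d\varphi\,\cdot,\dots,d\varphi\,\cdot)$ is the metric volume form of $g$ (for the orientation defined by $\theta$), and it is $\nabla$-parallel (so $\varphi$ is a Blaschke immersion with affine normal $\xi$ and Blaschke metric $g$); (c) the shape tensor $S$, defined by $\partial_X\xi=-d\varphi(SX)+\tau(X)\,\xi$ for some $1$-form $\tau$, vanishes. Let $J$ be a smooth almost complex structure on $M$ such that $g$ is $J$-Hermitian, i.e. $g(JX,JY)=g(X,Y)$, and such that the $2$-form $\omega:=g(J\cdot,\cdot)$ is $\nabla$-parallel (so the parabolic sphere is special). Then: 1. $J$ is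 integrable: $M$ admits the structure of a complex manifold, compatible with its smooth structure, whose multiplication by $i$ on tangent vectors is $J$; 2. the connection $\nabla^J=J\nabla J^{-1}$, i.e. $\nabla^J_XY=J\nabla_X(J^{-1}Y)$, is torsion-free. -/

import Mathlib

open Bundle Manifold
open scoped ContDiff

namespace ParabolicSphere

noncomputable section

variable {n : ℕ} {M : Type*} [TopologicalSpace M] [ChartedSpace (EuclideanSpace ℝ (Fin n)) M]
  [IsManifold (𝓡 n) ∞ M]

variable (n M) in
/-- Affine connections on `M`: covariant derivatives on the tangent bundle. As in Mathlib, `D Y x v`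
is `(∇_v Y)(x)`. -/
abbrev AffineConnection : Type _ :=
  CovariantDerivative (𝓡 n) (EuclideanSpace ℝ (Fin n)) (TangentSpace (𝓡 n) : M → Type _)

/-- The vector field `Y` is differentiable at `x`. -/
abbrev DiffFieldAt (Y : (y : M) → TangentSpace (𝓡 n) y) (x : M) : Prop :=
  MDifferentiableAt (𝓡 n) ((𝓡 n).prod 𝓘(ℝ, EuclideanSpace ℝ (Fin n)))
    (fun y ↦ TotalSpace.mk' (EuclideanSpace ℝ (Fin n)) (E := (TangentSpace (𝓡 n) : M → Type _))
      y (Y y)) x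

variable (n M) in
/-- A smooth pseudo-Riemannian metric (of arbitrary signature) on `M`. -/
structure PseudoRiemannianMetric where
  /-- The bilinear form on each tangent space. -/
  val (x : M) : TangentSpace (𝓡 n) x →L[ℝ] TangentSpace (𝓡 n) x →L[ℝ] ℝ
  symm (x : M) (v w : TangentSpace (𝓡 n) x) : val x v w = val x w v
  nondegenerate (x : M) (v : TangentSpace (𝓡 n) x) : (∀ w, val x v w = 0) → v = 0
  contMDiff : ContMDiff (𝓡 n)
    ((𝓡 n).prod 𝓘(ℝ, EuclideanSpace ℝ (Fin n) →L[ℝ] EuclideanSpace ℝ (Fin n) →L[ℝ] ℝ)) ∞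
    (fun x ↦ TotalSpace.mk' (EuclideanSpace ℝ (Fin n) →L[ℝ] EuclideanSpace ℝ (Fin n) →L[ℝ] ℝ)
      (E := fun x : M ↦ TangentSpace (𝓡 n) x →L[ℝ] TangentSpace (𝓡 n) x →L[ℝ] ℝ) x (val x))

variable (n M) in
/-- A smooth almost complex structure on `M`. -/
structure AlmostComplexStructure where
  /-- The endomorphism of each tangent space. -/
  val (x : M) : TangentSpace (𝓡 n) x →L[ℝ] TangentSpace (𝓡 n) x
  sq_eq_neg (x : M) (v : TangentSpace (𝓡 n) x) : val x (val x v) = -v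
  contMDiff : ContMDiff (𝓡 n)
    ((𝓡 n).prod 𝓘(ℝ, EuclideanSpace ℝ (Fin n) →L[ℝ] EuclideanSpace ℝ (Fin n))) ∞
    (fun x ↦ TotalSpace.mk' (EuclideanSpace ℝ (Fin n) →L[ℝ] EuclideanSpace ℝ (Fin n))
      (E := fun x : M ↦ TangentSpace (𝓡 n) x →L[ℝ] TangentSpace (𝓡 n) x) x (val x))

/-! ### Hypersurface immersions into `ℝ^(n+1)` -/

/-- The volume form `θ = det(ξ, dφ ·, …, dφ ·)` induced on `M` by a map `φ : M → ℝ^(n+1)` and a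
vector field `ξ` along `φ`. -/
def inducedVolume (φ ξ : M → (Fin (n + 1) → ℝ)) (x : M) :
    TangentSpace (𝓡 n) x [⋀^Fin n]→ₗ[ℝ] ℝ :=
  ((Matrix.detRowAlternating (R := ℝ) (n := Fin (n + 1))).curryLeft (ξ x)).compLinearMap
    (mvfderiv (𝓡 n) φ x).toLinearMap

/-- A field `θ` of alternating `n`-forms is parallel for the connection `D`:
`v (θ(Y₁, …, Yₙ)) = ∑ i, θ(Y₁, …, ∇_v Yᵢ, …, Yₙ)`. -/
def IsParallelVolume (D : AffineConnection n M)
    (θ : (x : M) → TangentSpace (𝓡 n) x [⋀^Fin n]→ₗ[ℝ] ℝ) : Prop :=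
  ∀ (x : M) (Y : Fin n → (y : M) → TangentSpace (𝓡 n) y), (∀ i, DiffFieldAt (Y i) x) →
    ∀ v : TangentSpace (𝓡 n) x,
      mvfderiv (𝓡 n) (fun y ↦ θ y (fun i ↦ Y i y)) x v =
        ∑ i, θ x (Function.update (fun j ↦ Y j x) i (D (Y i) x v))

/-- The (unsigned) metric volume `√|det (g(vᵢ, vⱼ))|` of an `n`-tuple of tangent vectors. -/
def metricVolume (g : PseudoRiemannianMetric n M) (x : M)
    (v : Fin n → TangentSpace (𝓡 n) x) : ℝ :=
  √|(Matrix.of fun i j ↦ g.val x (v i) (v j)).det|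

/-- `φ : M → ℝ^(n+1)` is a Blaschke immersion with affine normal `ξ`, which induces the connection
`D` and the Blaschke metric `g`. -/
structure IsBlaschkeImmersion (φ ξ : M → (Fin (n + 1) → ℝ)) (D : AffineConnection n M)
    (g : PseudoRiemannianMetric n M) : Prop where
  contMDiff : ContMDiff (𝓡 n) 𝓘(ℝ, Fin (n + 1) → ℝ) ∞ φ
  immersion (x : M) : Function.Injective (mvfderiv (𝓡 n) φ x)
  contMDiff_normal : ContMDiff (𝓡 n) 𝓘(ℝ, Fin (n + 1) → ℝ) ∞ ξ
  transversal (x : M) : ξ x ∉ Set.range (mvfderiv (𝓡 n) φ x)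
  /-- The Gauss formula `∂_v (dφ Y) = dφ (∇_v Y) + g(v, Y) ξ`, which says that `D` and `g` are
  induced by `φ` and `ξ`. -/
  gauss (x : M) (Y : (y : M) → TangentSpace (𝓡 n) y) : DiffFieldAt Y x →
    ∀ v : TangentSpace (𝓡 n) x,
      mvfderiv (𝓡 n) (fun y ↦ mvfderiv (𝓡 n) φ y (Y y)) x v =
        mvfderiv (𝓡 n) φ x (D Y x v) + g.val x v (Y x) • ξ x
  /-- The induced volume form `θ` is the metric volume form of `g` (for the orientation which `θ`
  defines on `M`). -/
  volume_eq (x : M) (v : Fin n → TangentSpace (𝓡 n) x) :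
    |inducedVolume φ ξ x v| = metricVolume g x v
  /-- The metric volume form, which is `θ`, is parallel for the induced connection. -/
  parallel_volume : IsParallelVolume D (inducedVolume φ ξ)

/-- `S` is the shape tensor of `φ` with transversal field `ξ`: the Weingarten formula
`∂_v ξ = -dφ(S v) + τ(v) ξ` holds for some 1-form `τ`. -/
def IsShapeTensor (φ ξ : M → (Fin (n + 1) → ℝ))
    (S : (x : M) → TangentSpace (𝓡 n) x →ₗ[ℝ] TangentSpace (𝓡 n) x) : Prop :=
  ∃ τ : (x : M) → TangentSpace (𝓡 n) x →ₗ[ℝ] ℝ, ∀ (x : M) (v : TangentSpace (𝓡 n) x),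
    mvfderiv (𝓡 n) ξ x v = -mvfderiv (𝓡 n) φ x (S x v) + τ x v • ξ x

/-- A Blaschke immersion is an affine hypersphere with constant `c` if its shape tensor is
`c • Id`. -/
def IsAffineHypersphere (φ ξ : M → (Fin (n + 1) → ℝ)) (D : AffineConnection n M)
    (g : PseudoRiemannianMetric n M) (c : ℝ) : Prop :=
  IsBlaschkeImmersion φ ξ D g ∧ IsShapeTensor φ ξ (fun _ ↦ c • LinearMap.id)

/-- `(M, D, g)` is a parabolic sphere: `D` and `g` are the connection and the Blaschke metric
induced by an affine hypersphere with constant `0`. -/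
def IsParabolicSphere (D : AffineConnection n M) (g : PseudoRiemannianMetric n M) : Prop :=
  ∃ φ ξ : M → (Fin (n + 1) → ℝ), IsAffineHypersphere φ ξ D g 0

/-! ### Special parabolic spheres -/

/-- `g` is Hermitian for `J`. -/
def IsHermitian (g : PseudoRiemannianMetric n M) (J : AlmostComplexStructure n M) : Prop :=
  ∀ (x : M) (v w : TangentSpace (𝓡 n) x), g.val x (J.val x v) (J.val x w) = g.val x v w

/-- The form `ω = g(J ·, ·)`. -/
def fundamentalForm (g : PseudoRiemannianMetric n M) (J : AlmostComplexStructure n M) (x : M) :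
    TangentSpace (𝓡 n) x →L[ℝ] TangentSpace (𝓡 n) x →L[ℝ] ℝ :=
  (g.val x).comp (J.val x)

/-- A field `Ω` of bilinear forms is parallel for `D`:
`v (Ω(Y, Z)) = Ω(∇_v Y, Z) + Ω(Y, ∇_v Z)`. -/
def IsParallelForm (D : AffineConnection n M)
    (Ω : (x : M) → TangentSpace (𝓡 n) x →L[ℝ] TangentSpace (𝓡 n) x →L[ℝ] ℝ) : Prop :=
  ∀ (x : M) (Y Z : (y : M) → TangentSpace (𝓡 n) y), DiffFieldAt Y x → DiffFieldAt Z x →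
    ∀ v : TangentSpace (𝓡 n) x,
      mvfderiv (𝓡 n) (fun y ↦ Ω y (Y y) (Z y)) x v =
        Ω x (D Y x v) (Z x) + Ω x (Y x) (D Z x v)

/-- The parabolic sphere `(M, D, g)` is special by means of the almost complex structure `J`. -/
structure IsSpecialParabolicSphere (D : AffineConnection n M) (g : PseudoRiemannianMetric n M)
    (J : AlmostComplexStructure n M) : Prop where
  parabolic : IsParabolicSphere D g
  hermitian : IsHermitian g J
  parallel : IsParallelForm D (fundamentalForm g J)

/-! ### Integrability and the conjugate connection -/

/-- `e` is a holomorphic coordinate system for `J`: a diffeomorphism from an open subset of `M` to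
an open subset of `ℂ^m` whose differential intertwines `J` with multiplication by `i`. -/
structure IsHolomorphicChart (J : AlmostComplexStructure n M) {m : ℕ}
    (e : OpenPartialHomeomorph M (EuclideanSpace ℂ (Fin m))) : Prop where
  contMDiffOn : ContMDiffOn (𝓡 n) 𝓘(ℝ, EuclideanSpace ℂ (Fin m)) ∞ e e.source
  contMDiffOn_symm : ContMDiffOn 𝓘(ℝ, EuclideanSpace ℂ (Fin m)) (𝓡 n) ∞ e.symm e.target
  map_J (x : M) (hx : x ∈ e.source) (v : TangentSpace (𝓡 n) x) :
    mvfderiv (𝓡 n) e x (J.val x v) = Complex.I • mvfderiv (𝓡 n) e x v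

/-- `J` is integrable: `M` has the structure of a complex manifold, compatible with its smooth
structure, whose multiplication by `i` on tangent vectors is `J`. -/
def IsIntegrable (J : AlmostComplexStructure n M) : Prop :=
  ∃ (m : ℕ) (C : ChartedSpace (EuclideanSpace ℂ (Fin m)) M),
    IsManifold 𝓘(ℂ, EuclideanSpace ℂ (Fin m)) ω M ∧
      ∀ e ∈ C.atlas, IsHolomorphicChart J e

theorem AlmostComplexStructure.mdifferentiableAt (J : AlmostComplexStructure n M)
    {Y : (y : M) → TangentSpace (𝓡 n) y} {x : M} (hY : DiffFieldAt Y x) :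
    DiffFieldAt (fun y ↦ J.val y (Y y)) x :=
  MDifferentiableAt.clm_bundle_apply
    ((J.contMDiff x).mdifferentiableAt (by simp)) hY

/-- The inverse `J⁻¹ = -J`, applied to a vector field. -/
def AlmostComplexStructure.invField (J : AlmostComplexStructure n M)
    (Y : (y : M) → TangentSpace (𝓡 n) y) : (y : M) → TangentSpace (𝓡 n) y :=
  -fun y ↦ J.val y (Y y)

/-- The connection `∇^J = J ∇ J⁻¹`, that is `∇^J_v Y = J (∇_v (J⁻¹ Y))`. -/
def conjConnection (J : AlmostComplexStructure n M) (D : AffineConnection n M) :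
    AffineConnection n M where
  toFun Y x := (J.val x).comp (D (J.invField Y) x)
  isCovariantDerivativeOnUniv := by
    have hd : ∀ {Y : (y : M) → TangentSpace (𝓡 n) y} {x : M}, DiffFieldAt Y x →
        DiffFieldAt (J.invField Y) x := fun hY ↦
      mdifferentiableAt_neg_section (J.mdifferentiableAt hY)
    refine ⟨fun {Y Z x} hY hZ _ ↦ ?_, fun {Y f x} hY hf _ ↦ ?_⟩
    · have h : J.invField (Y + Z) = J.invField Y + J.invField Z := by
        funext y
        simp [AlmostComplexStructure.invField]
        abel
      rw [h, D.isCovariantDerivativeOnUniv.add (hd hY) (hd hZ)]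
      simp
    · have h : J.invField (f • Y) = f • J.invField Y := by
        funext y
        simp [AlmostComplexStructure.invField]
      rw [h, D.isCovariantDerivativeOnUniv.leibniz (hd hY) hf]
      ext v
      simp [AlmostComplexStructure.invField, J.sq_eq_neg]

end

end ParabolicSphere

/-! Since S = 0, ∂ξ = τ ξ, and parallelism of θ forces τ = 0, so the affine normal ξ is locally
constant (`IsAffineHypersphere.mvfderiv_normal_eq_zero`). Near each point φ is therefore a graph in
the fixed direction ξ. Projection along ξ gives coordinates whose constant fields e_a are
∇-parallel, and the ξ-component f of φ satisfies d(e_a f) = g(·, e_a): ∇ is flat and torsion-free,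
and g is the Hessian of f (`IsAffineHypersphere.nonempty_hessianFrame`).

As ω and e_c are parallel, g(∇^J_v e_b, e_c) = ω(∇_v (J⁻¹ e_b), e_c) = v(g(e_b, e_c)). For v = e_a
this is a third derivative of f, symmetric in a and b, so ∇^J has no torsion.

For integrability, the coefficients ω(e_a, e_b) are locally constant, so ω(·, e_b) has an explicit
primitive r_b. The function h_b = r_b + i (e_b f) has differential g(J·, e_b) + i g(·, e_b), hence
dh_b ∘ J = i dh_b. For b in a basis, these n functions have jointly injective differential, and n/2
suitable complex combinations of them are local coordinates by the inverse function theorem.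
Holomorphic charts are thus explicit, without the Newlander–Nirenberg theorem. Transition maps are
real smooth with complex-linear differential, hence analytic (`contDiffOn_omega_of_real`). -/

section Holomorphic

/-! ### Analyticity of complex-differentiable maps in several variables -/

open Metric Set Topology

universe u

/-- Cauchy's estimate for the derivative of a holomorphic function on a ball in a normed space. -/
theorem norm_fderiv_le_div_of_forall_closedBall_le {E F : Type*} [NormedAddCommGroup E]
    [NormedSpace ℂ E] [NormedAddCommGroup F] [NormedSpace ℂ F] {f : E → F} {x : E} {δ C : ℝ}
    {U : Set E} (hU : IsOpen U) (hδ : 0 < δ) (hf : DifferentiableOn ℂ f U)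
    (hsub : closedBall x δ ⊆ U) (hC : ∀ y ∈ closedBall x δ, ‖f y‖ ≤ C) :
    ‖fderiv ℂ f x‖ ≤ C / δ := by
  have hC0 : 0 ≤ C := (norm_nonneg _).trans (hC x (mem_closedBall_self hδ.le))
  refine ContinuousLinearMap.opNorm_le_bound _ (by positivity) fun v ↦ ?_
  rcases eq_or_ne v 0 with rfl | hv
  · simp
  have hv' : 0 < ‖v‖ := norm_pos_iff.2 hv
  have hmem : ∀ t ∈ closedBall (0 : ℂ) (δ / ‖v‖), x + t • v ∈ closedBall x δ := by
    intro t ht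
    rw [mem_closedBall_zero_iff, le_div_iff₀ hv'] at ht
    simpa [norm_smul] using ht
  have hd : ∀ t ∈ closedBall (0 : ℂ) (δ / ‖v‖), DifferentiableAt ℂ f (x + t • v) := fun t ht ↦
    hf.differentiableAt (hU.mem_nhds (hsub (hmem t ht)))
  have hderiv : deriv (fun t : ℂ ↦ f (x + t • v)) 0 = fderiv ℂ f x v := by
    simpa using DifferentiableAt.deriv_comp_add_smul (𝕜 := ℂ) (t := 0) (x := x) (y := v)
      (hd 0 (mem_closedBall_self (by positivity)))
  have hg : DifferentiableOn ℂ (fun t : ℂ ↦ f (x + t • v)) (closedBall 0 (δ / ‖v‖)) :=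
    fun t ht ↦ ((hd t ht).comp t (by fun_prop)).differentiableWithinAt
  have key := Complex.norm_deriv_le_of_forall_mem_sphere_norm_le (c := 0) (C := C)
    (R := δ / ‖v‖) (f := fun t : ℂ ↦ f (x + t • v)) (by positivity)
    (DifferentiableOn.diffContOnCl (hg.mono closure_ball_subset_closedBall))
    fun z hz ↦ hC _ (hmem z (sphere_subset_closedBall hz))
  rw [hderiv] at key
  calc ‖fderiv ℂ f x v‖ ≤ C / (δ / ‖v‖) := key
    _ = C / δ * ‖v‖ := by field_simp

/-- Cauchy's estimate applied k times, each derivative costing δ of the radius. The target varies in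
the induction because f is replaced by its derivative; `E` and `F` share a universe so that `E →L[ℂ]
F` stays in it. -/
theorem norm_iteratedFDeriv_le_of_forall_ball_le {E : Type u} [NormedAddCommGroup E]
    [NormedSpace ℂ E] (x : E) {δ : ℝ} (hδ : 0 < δ) (k : ℕ) :
    ∀ {F : Type u} [NormedAddCommGroup F] [NormedSpace ℂ F] {f : E → F} {R C : ℝ},
      ContDiffOn ℂ ∞ f (ball x R) → (∀ y ∈ ball x R, ‖f y‖ ≤ C) →
      ∀ y, dist y x + k * δ < R → ‖iteratedFDeriv ℂ k f y‖ ≤ C / δ ^ k := by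
  induction k with
  | zero =>
    intro F _ _ f R C hf hC y hy
    simpa using hC y (by simpa using hy)
  | succ k ih =>
    intro F _ _ f R C hf hC y hy
    have hsub : ball x (R - δ) ⊆ ball x R := ball_subset_ball (by linarith)
    rw [← norm_iteratedFDeriv_fderiv]
    have := ih (f := fderiv ℂ f) (R := R - δ) (C := C / δ)
      ((hf.fderiv_of_isOpen isOpen_ball (by simp)).mono hsub) ?_ y ?_
    · calc _ ≤ _ := this
        _ = C / δ ^ (k + 1) := by rw [pow_succ]; field_simp
    · intro z hz
      have hzs : closedBall z δ ⊆ ball x R := by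
        intro w hw
        rw [mem_ball] at hz ⊢
        rw [mem_closedBall] at hw
        linarith [dist_triangle w z x]
      exact norm_fderiv_le_div_of_forall_closedBall_le isOpen_ball hδ
        (hf.differentiableOn (by simp)) hzs fun w hw ↦ hC w (hzs hw)
    · push_cast at hy
      linarith

theorem iteratedDeriv_comp_add_smul_eq {𝕜 E F : Type*} [NontriviallyNormedField 𝕜]
    [NormedAddCommGroup E] [NormedSpace 𝕜 E] [NormedAddCommGroup F] [NormedSpace 𝕜 F] {f : E → F}
    {x y : E} {V : Set 𝕜} (hV : IsOpen V) (hf : ∀ t ∈ V, ContDiffAt 𝕜 ∞ f (x + t • y)) (k : ℕ) :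
    ∀ t ∈ V, iteratedDeriv k (fun s : 𝕜 ↦ f (x + s • y)) t =
      iteratedFDeriv 𝕜 k f (x + t • y) (fun _ ↦ y) := by
  induction k with
  | zero => simp
  | succ k ih =>
    intro t ht
    have hev : iteratedDeriv k (fun s : 𝕜 ↦ f (x + s • y)) =ᶠ[𝓝 t]
        fun t ↦ iteratedFDeriv 𝕜 k f (x + t • y) (fun _ ↦ y) := by
      filter_upwards [hV.mem_nhds ht] with s hs using ih s hs
    rw [iteratedDeriv_succ, hev.deriv_eq]
    exact ContDiffAt.deriv_fderiv_add_smul ((hf t ht).of_le (by exact_mod_cast le_top))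

/-- A function on an open subset of a complex normed space which is infinitely differentiable
over `ℂ` is analytic. -/
theorem ContDiffOn.analyticAt_of_complex {E F : Type u} [NormedAddCommGroup E] [NormedSpace ℂ E]
    [NormedAddCommGroup F] [NormedSpace ℂ F] [CompleteSpace F] {f : E → F} {U : Set E}
    (hU : IsOpen U) (hf : ContDiffOn ℂ ∞ f U) {x : E} (hx : x ∈ U) : AnalyticAt ℂ f x := by
  obtain ⟨R₀, hR₀, hb⟩ : ∃ R > 0, ∀ y ∈ ball x R, y ∈ U ∧ ‖f y‖ ≤ ‖f x‖ + 1 := by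
    have h1 : ∀ᶠ y in 𝓝 x, ‖f y‖ < ‖f x‖ + 1 :=
      (hf.continuousOn.continuousAt (hU.mem_nhds hx)).norm.eventually
        (eventually_lt_nhds (by linarith))
    obtain ⟨R, hR, h⟩ := Metric.eventually_nhds_iff_ball.1 (h1.and (hU.mem_nhds hx))
    exact ⟨R, hR, fun y hy ↦ ⟨(h y hy).2, (h y hy).1.le⟩⟩
  set C := ‖f x‖ + 1
  have hC0 : 0 ≤ C := by positivity
  have hsub : ball x R₀ ⊆ U := fun y hy ↦ (hb y hy).1
  set p : FormalMultilinearSeries ℂ E F := fun k ↦ ((k.factorial : ℂ)⁻¹) • iteratedFDeriv ℂ k f x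
  -- Cauchy's estimate with δ = R₀ / (2k) uses up only half of the radius and gives ‖p k‖ ≤ C (2k /
  -- R₀)^k / k!. Since k^k / k! ≤ e^k, this r makes ‖p k‖ r^k bounded.
  set r : ℝ := R₀ / (2 * Real.exp 1) with hr
  have hr0 : 0 < r := by positivity
  have hbound : ∀ k, ‖p k‖ * r ^ k ≤ C := by
    intro k
    rcases Nat.eq_zero_or_pos k with rfl | hk
    · simp only [p, C]
      simp
    have hk' : (0 : ℝ) < k := by exact_mod_cast hk
    have h1 := norm_iteratedFDeriv_le_of_forall_ball_le x (δ := R₀ / (2 * k)) (by positivity) k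
      (hf.mono hsub) (fun y hy ↦ (hb y hy).2) x (by
        rw [dist_self, zero_add]
        field_simp
        linarith)
    have h2 : (k : ℝ) ^ k / k.factorial ≤ Real.exp k :=
      Real.pow_div_factorial_le_exp k hk'.le k
    have h3 : ‖p k‖ = (k.factorial : ℝ)⁻¹ * ‖iteratedFDeriv ℂ k f x‖ := by
      simp [p, norm_smul]
    rw [h3]
    calc (k.factorial : ℝ)⁻¹ * ‖iteratedFDeriv ℂ k f x‖ * r ^ k
        ≤ (k.factorial : ℝ)⁻¹ * (C / (R₀ / (2 * k)) ^ k) * r ^ k := by gcongr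
      _ = C * ((k : ℝ) ^ k / k.factorial / Real.exp 1 ^ k) := by
        rw [hr, div_pow, div_pow, mul_pow, mul_pow]
        field_simp
      _ ≤ C * 1 := by
        gcongr
        rw [div_le_one (by positivity), ← Real.exp_nat_mul, mul_one]
        exact h2
      _ = C := mul_one C
  have hrR : r < R₀ := by
    rw [hr, div_lt_iff₀ (by positivity)]
    nlinarith [Real.add_one_le_exp (1 : ℝ)]
  refine ⟨p, ENNReal.ofReal r, ?_, ?_, ?_⟩
  · have := p.le_radius_of_bound (r := r.toNNReal) C (by
      simpa [Real.coe_toNNReal _ hr0.le] using hbound)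
    simpa [ENNReal.ofReal] using this
  · simpa using hr0
  · intro y hy
    have hy' : ‖y‖ < r := by
      rw [Metric.eball_ofReal, mem_ball_zero_iff] at hy
      exact hy
    -- The sum is identified on the complex line t ↦ x + t y: the one-variable Taylor series
    -- converges to f on a disc of radius R₀ / r > 1, in particular at t = 1.
    set V : Set ℂ := (fun t : ℂ ↦ x + t • y) ⁻¹' ball x R₀
    have hV : IsOpen V := isOpen_ball.preimage (by fun_prop)
    have hat : ∀ t ∈ V, ContDiffAt ℂ ∞ f (x + t • y) := fun t ht ↦
      hf.contDiffAt (hU.mem_nhds (hsub ht))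
    have hballV : ball (0 : ℂ) (R₀ / r) ⊆ V := by
      intro t ht
      rw [mem_ball_zero_iff, lt_div_iff₀ hr0] at ht
      have : ‖t‖ * ‖y‖ < R₀ := (mul_le_mul_of_nonneg_left hy'.le (norm_nonneg _)).trans_lt ht
      simpa [V, norm_smul] using this
    have hd : DifferentiableOn ℂ (fun t : ℂ ↦ f (x + t • y)) (ball 0 (R₀ / r)) := fun t ht ↦
      (((hat t (hballV ht)).differentiableAt (by simp)).comp t
        (by fun_prop)).differentiableWithinAt
    have h1 : (1 : ℂ) ∈ ball (0 : ℂ) (R₀ / r) := by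
      rw [mem_ball_zero_iff, norm_one, one_lt_div hr0]
      exact hrR
    have h0 : (0 : ℂ) ∈ V := hballV (mem_ball_self (by positivity))
    have := Complex.hasSum_taylorSeries_on_ball hd h1
    simp only [sub_zero, one_pow, one_smul] at this
    convert this using 2 with k
    rw [iteratedDeriv_comp_add_smul_eq hV hat k 0 h0]
    simp [p]

/-- The complex derivative is again real smooth and complex differentiable, so induction applies.
Complex differentiability comes from symmetry: the second real derivative is complex linear in its
second argument, hence also in its first. -/
theorem contDiffOn_complex_of_real {E : Type u} [NormedAddCommGroup E] [NormedSpace ℂ E]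
    [FiniteDimensional ℝ E] {U : Set E} (hU : IsOpen U) (k : ℕ) :
    ∀ {F : Type u} [NormedAddCommGroup F] [NormedSpace ℂ F] [FiniteDimensional ℝ F] {f : E → F},
      ContDiffOn ℝ ∞ f U → DifferentiableOn ℂ f U → ContDiffOn ℂ k f U := by
  induction k with
  | zero =>
    intro F _ _ _ f hf hd
    simpa using hf.continuousOn
  | succ k ih =>
    intro F _ _ _ f hf hd
    set ρ : (E →L[ℂ] F) →L[ℝ] (E →L[ℝ] F) := ContinuousLinearMap.restrictScalarsL ℂ E F ℝ ℝ
    have hρ : Function.Injective ρ := fun A B h ↦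
      ContinuousLinearMap.ext fun v ↦ congr($h v)
    have : FiniteDimensional ℝ (E →L[ℂ] F) :=
      FiniteDimensional.of_injective (ρ : (E →L[ℂ] F) →ₗ[ℝ] (E →L[ℝ] F)) hρ
    -- A left inverse of restriction of scalars recovers the complex derivative from the real one by
    -- a fixed linear map, so smoothness carries over.
    obtain ⟨T₀, hT₀⟩ := LinearMap.exists_leftInverse_of_injective
      (ρ : (E →L[ℂ] F) →ₗ[ℝ] (E →L[ℝ] F)) (LinearMap.ker_eq_bot.2 hρ)
    set T : (E →L[ℝ] F) →L[ℝ] (E →L[ℂ] F) := LinearMap.toContinuousLinearMap T₀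
    have hT : ∀ A, T (ρ A) = A := fun A ↦ LinearMap.congr_fun hT₀ A
    have hdat : ∀ x ∈ U, DifferentiableAt ℂ f x := fun x hx ↦ hd.differentiableAt (hU.mem_nhds hx)
    have hR : ∀ x ∈ U, fderiv ℝ f x = ρ (fderiv ℂ f x) := fun x hx ↦
      ((hdat x hx).hasFDerivAt.restrictScalars ℝ).fderiv
    have hC : ∀ x ∈ U, fderiv ℂ f x = T (fderiv ℝ f x) := fun x hx ↦ by rw [hR x hx, hT]
    have hreal : ContDiffOn ℝ ∞ (fderiv ℂ f) U :=
      (T.contDiff.comp_contDiffOn (hf.fderiv_of_isOpen hU (by simp))).congr hC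
    rw [show ((k + 1 : ℕ) : WithTop ℕ∞) = (k : WithTop ℕ∞) + 1 by norm_cast,
      contDiffOn_succ_iff_fderiv_of_isOpen hU]
    refine ⟨hd, by simp, ih hreal fun x hx ↦ DifferentiableAt.differentiableWithinAt ?_⟩
    have hxU := hU.mem_nhds hx
    have hdr : DifferentiableAt ℝ (fderiv ℂ f) x :=
      (hreal.contDiffAt hxU).differentiableAt (by simp)
    set A := fderiv ℝ (fderiv ℂ f) x
    have hA : ∀ v w, fderiv ℝ (fderiv ℝ f) x v w = A v w := by
      intro v w
      have hev : fderiv ℝ f =ᶠ[𝓝 x] ρ ∘ fderiv ℂ f := by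
        filter_upwards [hxU] with y hy using hR y hy
      rw [hev.fderiv_eq, (ρ.hasFDerivAt.comp x hdr.hasFDerivAt).fderiv]
      rfl
    have hsymm : ∀ v w, A v w = A w v := by
      intro v w
      have htwo : minSmoothness ℝ 2 ≤ ∞ := by
        rw [minSmoothness_of_isRCLikeNormedField]
        exact WithTop.coe_le_coe.2 (le_top : (2 : ℕ∞) ≤ ⊤)
      rw [← hA, ← hA]
      exact (hf.contDiffAt hxU).isSymmSndFDerivAt htwo v w
    rw [differentiableAt_iff_restrictScalars ℝ hdr]
    refine ⟨⟨⟨⟨A, map_add A⟩, fun c v ↦ ?_⟩, A.continuous⟩, rfl⟩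
    ext w
    change A (c • v) w = c • A v w
    rw [hsymm, map_smul, hsymm]

/-- A real smooth function between complex vector spaces which is differentiable over `ℂ` is
complex analytic. -/
theorem contDiffOn_omega_of_real {E F : Type u} [NormedAddCommGroup E] [NormedSpace ℂ E]
    [NormedAddCommGroup F] [NormedSpace ℂ F] [FiniteDimensional ℝ E] [FiniteDimensional ℝ F]
    {U : Set E} (hU : IsOpen U) {f : E → F} (hf : ContDiffOn ℝ ∞ f U)
    (hd : DifferentiableOn ℂ f U) : ContDiffOn ℂ ω f U := by
  have : CompleteSpace F := FiniteDimensional.complete ℝ F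
  have h : ContDiffOn ℂ ∞ f U :=
    contDiffOn_infty.2 fun k ↦ contDiffOn_complex_of_real hU k hf hd
  exact fun x hx ↦ (h.analyticAt_of_complex hU hx).contDiffAt.contDiffWithinAt

end Holomorphic

namespace ParabolicSphere

open Filter Topology Set

/-! ### Differential calculus on the manifold -/

section Calculus

variable {n : ℕ} {M : Type*} [TopologicalSpace M] [ChartedSpace (EuclideanSpace ℝ (Fin n)) M]
  {F G : Type*} [NormedAddCommGroup F] [NormedSpace ℝ F] [NormedAddCommGroup G] [NormedSpace ℝ G]

theorem mvfderiv_congr_of_eventuallyEq {f g : M → F} {x : M} (h : f =ᶠ[𝓝 x] g)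
    (v : TangentSpace (𝓡 n) x) : mvfderiv (𝓡 n) f x v = mvfderiv (𝓡 n) g x v :=
  congr($(h.mfderiv_eq) v)

theorem mvfderiv_comp_of_differentiableAt {f : M → F} {L : F → G} {x : M}
    (hL : DifferentiableAt ℝ L (f x)) (hf : MDifferentiableAt (𝓡 n) 𝓘(ℝ, F) f x)
    (v : TangentSpace (𝓡 n) x) :
    mvfderiv (𝓡 n) (fun y ↦ L (f y)) x v = fderiv ℝ L (f x) (mvfderiv (𝓡 n) f x v) := by
  have h := mfderiv_comp_apply x hL.mdifferentiableAt hf v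
  rw [mfderiv_eq_fderiv] at h
  exact h

theorem mvfderiv_clm_comp {f : M → F} (L : F →L[ℝ] G) {x : M}
    (hf : MDifferentiableAt (𝓡 n) 𝓘(ℝ, F) f x) (v : TangentSpace (𝓡 n) x) :
    mvfderiv (𝓡 n) (fun y ↦ L (f y)) x v = L (mvfderiv (𝓡 n) f x v) := by
  rw [mvfderiv_comp_of_differentiableAt L.differentiableAt hf, L.fderiv]

theorem mvfderiv_pi_apply {ι : Type*} [Fintype ι] {f : M → ι → F} {x : M}
    (hf : MDifferentiableAt (𝓡 n) 𝓘(ℝ, ι → F) f x) (v : TangentSpace (𝓡 n) x) (i : ι) :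
    mvfderiv (𝓡 n) f x v i = mvfderiv (𝓡 n) (fun y ↦ f y i) x v :=
  (mvfderiv_clm_comp (ContinuousLinearMap.proj (R := ℝ) (φ := fun _ : ι ↦ F) i) hf v).symm

theorem mvfderiv_det {N : ℕ} {W : M → Fin N → Fin N → ℝ} {x : M}
    (hW : MDifferentiableAt (𝓡 n) 𝓘(ℝ, Fin N → Fin N → ℝ) W x) (v : TangentSpace (𝓡 n) x) :
    mvfderiv (𝓡 n) (fun y ↦ Matrix.detRowAlternating (R := ℝ) (W y)) x v =
      ∑ i, Matrix.detRowAlternating (R := ℝ)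
        (Function.update (W x) i (mvfderiv (𝓡 n) (fun y ↦ W y i) x v)) := by
  set f : ContinuousMultilinearMap ℝ (fun _ : Fin N ↦ Fin N → ℝ) ℝ :=
    ⟨(Matrix.detRowAlternating (R := ℝ) (n := Fin N)).toMultilinearMap, by
      exact continuous_id.matrix_det⟩
  have hf := f.hasFDerivAt (W x)
  have := mvfderiv_comp_of_differentiableAt hf.differentiableAt hW v
  rw [hf.fderiv, ContinuousMultilinearMap.linearDeriv_apply] at this
  simp only [mvfderiv_pi_apply hW] at this
  exact this

theorem inducedVolume_apply {φ ξ : M → (Fin (n + 1) → ℝ)} (x : M) (v : Fin n → TangentSpace (𝓡 n) x) :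
    inducedVolume φ ξ x v = Matrix.detRowAlternating (R := ℝ)
      (Fin.cons (ξ x) fun i ↦ mvfderiv (𝓡 n) φ x (v i)) := rfl

variable [IsManifold (𝓡 n) ∞ M]

/-- The derivative of a smooth function along a smooth vector field is smooth. -/
theorem contMDiffAt_mvfderiv_apply {φ : M → F} (hφ : ContMDiff (𝓡 n) 𝓘(ℝ, F) ∞ φ)
    {Y : (y : M) → TangentSpace (𝓡 n) y} {x : M}
    (hY : ContMDiffAt (𝓡 n) ((𝓡 n).prod 𝓘(ℝ, EuclideanSpace ℝ (Fin n))) ∞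
      (fun y ↦ (⟨y, Y y⟩ : TangentBundle (𝓡 n) M)) x) :
    ContMDiffAt (𝓡 n) 𝓘(ℝ, F) ∞ (fun y ↦ mvfderiv (𝓡 n) φ y (Y y)) x := by
  have h1 : ContMDiff (𝓡 n).tangent 𝓘(ℝ, F).tangent ∞ (tangentMap (𝓡 n) 𝓘(ℝ, F) φ) :=
    hφ.contMDiff_tangentMap (by simp)
  exact (contMDiff_snd_tangentBundle_modelSpace F 𝓘(ℝ, F)).contMDiffAt.comp x
    (h1.contMDiffAt.comp x hY)

/-- A function with zero derivative is locally constant. -/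
theorem eventually_eq_of_mvfderiv_eq_zero {f : M → F} (hf : ContMDiff (𝓡 n) 𝓘(ℝ, F) ∞ f)
    (h : ∀ x v, mvfderiv (𝓡 n) f x v = 0) (x₀ : M) : ∀ᶠ y in 𝓝 x₀, f y = f x₀ := by
  set ψ := extChartAt (𝓡 n) x₀
  have htar : IsOpen ψ.target := isOpen_extChartAt_target x₀
  have hmf : ∀ z ∈ ψ.target, MDifferentiableAt 𝓘(ℝ, EuclideanSpace ℝ (Fin n)) (𝓡 n) ψ.symm z :=
    fun z hz ↦ (((contMDiffOn_extChartAt_symm (n := ∞) x₀).contMDiffAt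
      (htar.mem_nhds hz)).mdifferentiableAt (by simp))
  have hzero : ∀ z ∈ ψ.target, HasFDerivAt (f ∘ ψ.symm) (0 : EuclideanSpace ℝ (Fin n) →L[ℝ] F) z := by
    intro z hz
    have hfz := (hf.mdifferentiable (by simp)) (ψ.symm z)
    have h0 : mfderiv (𝓡 n) 𝓘(ℝ, F) f (ψ.symm z) = 0 := by
      ext v
      exact h _ v
    have := hfz.hasMFDerivAt.comp z (hmf z hz).hasMFDerivAt
    rw [h0] at this
    have h2 := hasMFDerivAt_iff_hasFDerivAt.1 this
    convert! h2
  obtain ⟨r, hr, hball⟩ := Metric.isOpen_iff.1 htar (ψ x₀) (mem_extChartAt_target x₀)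
  have hpre : ψ ⁻¹' Metric.ball (ψ x₀) r ∈ 𝓝 x₀ :=
    (continuousAt_extChartAt x₀).preimage_mem_nhds (Metric.ball_mem_nhds _ hr)
  filter_upwards [hpre, extChartAt_source_mem_nhds (I := 𝓡 n) x₀] with y hy hys
  have := (convex_ball (ψ x₀) r).is_const_of_fderivWithin_eq_zero (𝕜 := ℝ) (f := f ∘ ψ.symm)
    (fun z hz ↦ (hzero z (hball hz)).differentiableAt.differentiableWithinAt)
    (fun z hz ↦ ((hzero z (hball hz)).hasFDerivWithinAt).fderivWithin
      (Metric.isOpen_ball.uniqueDiffWithinAt hz)) hy (Metric.mem_ball_self hr)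
  simpa [ψ.left_inv hys, ψ.left_inv (mem_extChartAt_source x₀)] using this

end Calculus

/-! ### Constancy of the affine normal -/

section Normal

variable {n : ℕ} {M : Type*} [TopologicalSpace M] [ChartedSpace (EuclideanSpace ℝ (Fin n)) M]
  [IsManifold (𝓡 n) ∞ M] {φ ξ : M → (Fin (n + 1) → ℝ)} {D : AffineConnection n M}
  {g : PseudoRiemannianMetric n M}

theorem IsBlaschkeImmersion.inducedVolume_ne_zero (h : IsBlaschkeImmersion φ ξ D g) (x : M)
    {v : Fin n → TangentSpace (𝓡 n) x} (hv : LinearIndependent ℝ v) :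
    inducedVolume φ ξ x v ≠ 0 := by
  rw [inducedVolume_apply]
  have hli : LinearIndependent ℝ (Fin.cons (ξ x) fun i ↦ mvfderiv (𝓡 n) φ x (v i) :
      Fin (n + 1) → Fin (n + 1) → ℝ) := by
    rw [linearIndependent_finCons]
    refine ⟨hv.map' (mvfderiv (𝓡 n) φ x).toLinearMap (LinearMap.ker_eq_bot.2 (h.immersion x)),
      fun hx ↦ h.transversal x ?_⟩
    have : Submodule.span ℝ (range fun i ↦ mvfderiv (𝓡 n) φ x (v i)) ≤
        LinearMap.range (mvfderiv (𝓡 n) φ x).toLinearMap :=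
      Submodule.span_le.2 (by rintro _ ⟨i, rfl⟩; exact ⟨v i, rfl⟩)
    exact this hx
  have := Matrix.linearIndependent_rows_iff_isUnit (A := Matrix.of (Fin.cons (ξ x) fun i ↦
    mvfderiv (𝓡 n) φ x (v i) : Fin (n + 1) → Fin (n + 1) → ℝ)) |>.1 hli
  exact ((Matrix.isUnit_iff_isUnit_det _).1 this).ne_zero

/-- The affine normal of a parabolic sphere is constant. -/
theorem IsAffineHypersphere.mvfderiv_normal_eq_zero (h : IsAffineHypersphere φ ξ D g 0) (x : M)
    (v : TangentSpace (𝓡 n) x) : mvfderiv (𝓡 n) ξ x v = 0 := by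
  obtain ⟨hB, τ, hτ⟩ := h
  have hξ : mvfderiv (𝓡 n) ξ x v = τ x v • ξ x := by
    simpa using hτ x v
  let b : Fin n → TangentSpace (𝓡 n) x := fun i ↦ EuclideanSpace.basisFun (Fin n) ℝ i
  have hb : LinearIndependent ℝ b := (EuclideanSpace.basisFun (Fin n) ℝ).toBasis.linearIndependent
  let Y : Fin n → (y : M) → TangentSpace (𝓡 n) y := fun i ↦
    FiberBundle.extend (EuclideanSpace ℝ (Fin n)) (b i)
  have hYx : ∀ i, Y i x = b i := fun i ↦ FiberBundle.extend_apply_self _ _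
  have hYs : ∀ i, ContMDiffAt (𝓡 n) ((𝓡 n).prod 𝓘(ℝ, EuclideanSpace ℝ (Fin n))) ∞
      (fun y ↦ (⟨y, Y i y⟩ : TangentBundle (𝓡 n) M)) x := fun i ↦
    FiberBundle.contMDiffAt_extend _ _ _
  have hYd : ∀ i, DiffFieldAt (Y i) x := fun i ↦ (hYs i).mdifferentiableAt (by simp)
  let W : M → Fin (n + 1) → Fin (n + 1) → ℝ := fun y ↦
    Fin.cons (ξ y) fun i ↦ mvfderiv (𝓡 n) φ y (Y i y)
  have hW : MDifferentiableAt (𝓡 n) 𝓘(ℝ, Fin (n + 1) → Fin (n + 1) → ℝ) W x := by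
    refine ContMDiffAt.mdifferentiableAt (n := ∞) ?_ (by simp)
    rw [contMDiffAt_pi_space]
    intro i
    refine Fin.cases ?_ (fun j ↦ ?_) i
    · exact hB.contMDiff_normal x
    · exact contMDiffAt_mvfderiv_apply hB.contMDiff (hYs j)
  have hpar := hB.parallel_volume x Y hYd v
  have hdet : mvfderiv (𝓡 n) (fun y ↦ inducedVolume φ ξ y (fun i ↦ Y i y)) x v = _ :=
    mvfderiv_det hW v
  rw [hdet, Fin.sum_univ_succ] at hpar
  -- Differentiating the ξ row contributes τ θ, the only term absent from the parallelism identity.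
  have hfirst : Matrix.detRowAlternating (R := ℝ) (Function.update (W x) 0
      (mvfderiv (𝓡 n) (fun y ↦ W y 0) x v)) =
      τ x v * inducedVolume φ ξ x (fun i ↦ Y i x) := by
    have h0 : mvfderiv (𝓡 n) (fun y ↦ W y 0) x v = τ x v • W x 0 := hξ
    rw [h0, AlternatingMap.map_update_smul, Function.update_eq_self]
    rfl
  -- By the Gauss formula the derivative of such a row is dφ(∇Y) plus a multiple of ξ, which repeats
  -- row 0 and drops out.
  have hrest : ∀ j : Fin n, Matrix.detRowAlternating (R := ℝ) (Function.update (W x) j.succ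
      (mvfderiv (𝓡 n) (fun y ↦ W y j.succ) x v)) =
      inducedVolume φ ξ x (Function.update (fun j ↦ Y j x) j (D (Y j) x v)) := by
    intro j
    have hj : mvfderiv (𝓡 n) (fun y ↦ W y j.succ) x v =
        mvfderiv (𝓡 n) φ x (D (Y j) x v) + g.val x v (Y j x) • W x 0 := hB.gauss x (Y j) (hYd j) v
    rw [hj, AlternatingMap.map_update_add, AlternatingMap.map_update_smul,
      AlternatingMap.map_update_self _ _ (Fin.succ_ne_zero j), smul_zero, add_zero,
      inducedVolume_apply]
    congr 1
    rw [← Fin.cons_update]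
    congr 1
    ext i : 1
    by_cases hij : i = j
    · subst hij; simp
    · simp [hij]
  rw [hfirst, Finset.sum_congr rfl fun j _ ↦ hrest j] at hpar
  have hz : τ x v * inducedVolume φ ξ x (fun i ↦ Y i x) = 0 := by linarith
  rw [hξ]
  have hne : inducedVolume φ ξ x (fun i ↦ Y i x) ≠ 0 := by
    simp only [hYx]
    exact hB.inducedVolume_ne_zero x hb
  rw [(mul_eq_zero.1 hz).resolve_right hne, zero_smul]

end Normal

end ParabolicSphere

/-! ### Affine coordinates and the Hessian structure -/

namespace ParabolicSphere

open Filter Topology Set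

/-- A projection along a nonzero vector, and a linear form with value `1` on this vector. -/
theorem exists_projection_along {n : ℕ} {w : Fin (n + 1) → ℝ} (hw : w ≠ 0) :
    ∃ (q : (Fin (n + 1) → ℝ) →L[ℝ] EuclideanSpace ℝ (Fin n)) (l : (Fin (n + 1) → ℝ) →L[ℝ] ℝ),
      (∀ u, q u = 0 → ∃ c : ℝ, u = c • w) ∧ q w = 0 ∧ l w = 1 := by
  obtain ⟨l, hl⟩ := SeparatingDual.exists_eq_one (R := ℝ) hw
  have hfin : Module.finrank ℝ ((Fin (n + 1) → ℝ) ⧸ Submodule.span ℝ {w}) =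
      Module.finrank ℝ (EuclideanSpace ℝ (Fin n)) := by
    have h1 := (Submodule.span ℝ {w}).finrank_quotient_add_finrank
    rw [finrank_span_singleton hw, Module.finrank_fin_fun] at h1
    rw [finrank_euclideanSpace_fin]
    omega
  let e := LinearEquiv.ofFinrankEq _ _ hfin
  refine ⟨LinearMap.toContinuousLinearMap (e.toLinearMap ∘ₗ (Submodule.span ℝ {w}).mkQ), l,
    fun u hu ↦ ?_, ?_, hl⟩
  · have hu' : e ((Submodule.span ℝ {w}).mkQ u) = 0 := hu
    rw [LinearEquiv.map_eq_zero_iff, Submodule.mkQ_apply, Submodule.Quotient.mk_eq_zero,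
      Submodule.mem_span_singleton] at hu'
    obtain ⟨c, hc⟩ := hu'
    exact ⟨c, hc.symm⟩
  · change e ((Submodule.span ℝ {w}).mkQ w) = 0
    rw [LinearEquiv.map_eq_zero_iff, Submodule.mkQ_apply, Submodule.Quotient.mk_eq_zero]
    exact Submodule.mem_span_singleton_self w

theorem mlieBracket_const {E : Type*} [NormedAddCommGroup E] [NormedSpace ℝ E] (a b z : E) :
    VectorField.mlieBracket 𝓘(ℝ, E) (M := E) (fun _ ↦ a) (fun _ ↦ b) z = 0 := by
  have h := congrFun (VectorField.mlieBracketWithin_eq_lieBracketWithin (𝕜 := ℝ) (E := E)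
    (V := fun _ ↦ a) (W := fun _ ↦ b) (s := univ)) z
  have h2 : VectorField.lieBracketWithin ℝ (fun _ : E ↦ a) (fun _ ↦ b) univ z = 0 := by
    simp [VectorField.lieBracketWithin_eq]
  exact h.trans h2

variable {n : ℕ} {M : Type*} [TopologicalSpace M] [ChartedSpace (EuclideanSpace ℝ (Fin n)) M]

theorem isInvertible_mfderiv_of_injective {p : M → EuclideanSpace ℝ (Fin n)} {y : M}
    (h : Function.Injective (mvfderiv (𝓡 n) p y)) :
    (mfderiv (𝓡 n) 𝓘(ℝ, EuclideanSpace ℝ (Fin n)) p y).IsInvertible := by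
  let A : EuclideanSpace ℝ (Fin n) →L[ℝ] EuclideanSpace ℝ (Fin n) := mvfderiv (𝓡 n) p y
  exact ⟨(LinearEquiv.ofInjectiveEndo A.toLinearMap h).toContinuousLinearEquiv, by ext v : 1; rfl⟩

variable [IsManifold (𝓡 n) ∞ M]

/-- The vector field is smooth at the point. -/
abbrev SmoothFieldAt (Y : (y : M) → TangentSpace (𝓡 n) y) (x : M) : Prop :=
  ContMDiffAt (𝓡 n) ((𝓡 n).prod 𝓘(ℝ, EuclideanSpace ℝ (Fin n))) ∞
    (fun y ↦ TotalSpace.mk' (EuclideanSpace ℝ (Fin n)) (E := (TangentSpace (𝓡 n) : M → Type _))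
      y (Y y)) x

/-- A frame of commuting `D`-parallel vector fields near `x₀`, indexed by the values of affine
coordinates on them, such that the 1-forms dual to these vector fields for `g` are exact. -/
structure HessianFrame (D : AffineConnection n M) (g : PseudoRiemannianMetric n M) (x₀ : M) where
  domain : Set M
  isOpen_domain : IsOpen domain
  mem_domain : x₀ ∈ domain
  coord : M → EuclideanSpace ℝ (Fin n)
  contMDiff_coord : ContMDiff (𝓡 n) 𝓘(ℝ, EuclideanSpace ℝ (Fin n)) ∞ coord
  injective_coord : ∀ y ∈ domain, Function.Injective (mvfderiv (𝓡 n) coord y)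
  field : EuclideanSpace ℝ (Fin n) → (y : M) → TangentSpace (𝓡 n) y
  smooth_field : ∀ a, ∀ y ∈ domain, SmoothFieldAt (field a) y
  coord_field : ∀ a, ∀ y ∈ domain, mvfderiv (𝓡 n) coord y (field a y) = a
  parallel_field : ∀ a, ∀ y ∈ domain, ∀ v, D (field a) y v = 0
  mlieBracket_field : ∀ a b, ∀ y ∈ domain, VectorField.mlieBracket (𝓡 n) (field a) (field b) y = 0
  potential : EuclideanSpace ℝ (Fin n) → M → ℝ
  contMDiffAt_potential : ∀ a, ∀ y ∈ domain, ContMDiffAt (𝓡 n) 𝓘(ℝ, ℝ) ∞ (potential a) y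
  mvfderiv_potential : ∀ a, ∀ y ∈ domain, ∀ v,
    mvfderiv (𝓡 n) (potential a) y v = g.val y v (field a y)

variable {φ ξ : M → (Fin (n + 1) → ℝ)} {D : AffineConnection n M}
  {g : PseudoRiemannianMetric n M}

/-- Where ξ is constant, split the ambient space by q (projection along ξ) and l (with l ξ = 1). The
coordinates are q ∘ φ, and the Gauss formula for a constant coordinate field e_a separates: its
q-part gives ∇e_a = 0, its l-part makes l(dφ e_a) a primitive of g(·, e_a). -/
theorem IsAffineHypersphere.nonempty_hessianFrame (h : IsAffineHypersphere φ ξ D g 0) (x₀ : M) :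
    Nonempty (HessianFrame D g x₀) := by
  have hB := h.1
  have hM2 : IsManifold (𝓡 n) (minSmoothness ℝ 2) M := by
    rw [minSmoothness_of_isRCLikeNormedField]
    infer_instance
  obtain ⟨U, hUsub, hU, hxU⟩ := mem_nhds_iff.1
    (eventually_eq_of_mvfderiv_eq_zero hB.contMDiff_normal h.mvfderiv_normal_eq_zero x₀)
  have hξU : ∀ y ∈ U, ξ y = ξ x₀ := fun y hy ↦ hUsub hy
  have hξ0 : ξ x₀ ≠ 0 := fun h0 ↦ hB.transversal x₀ (h0 ▸ ⟨0, map_zero _⟩)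
  obtain ⟨q, l, hqker, hqξ, hlξ⟩ := exists_projection_along hξ0
  let p : M → EuclideanSpace ℝ (Fin n) := fun y ↦ q (φ y)
  have hp : ContMDiff (𝓡 n) 𝓘(ℝ, EuclideanSpace ℝ (Fin n)) ∞ p :=
    q.contMDiff.comp hB.contMDiff
  have hdp : ∀ y v, mvfderiv (𝓡 n) p y v = q (mvfderiv (𝓡 n) φ y v) := fun y v ↦
    mvfderiv_clm_comp q (hB.contMDiff.mdifferentiable (by simp) y) v
  have hinj : ∀ y ∈ U, Function.Injective (mvfderiv (𝓡 n) p y) := by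
    intro y hy
    rw [injective_iff_map_eq_zero]
    intro v hv
    rw [hdp] at hv
    obtain ⟨c, hc⟩ := hqker _ hv
    rcases eq_or_ne c 0 with rfl | hc0
    · rw [zero_smul] at hc
      exact hB.immersion y (hc.trans (map_zero _).symm)
    · refine absurd ⟨c⁻¹ • v, ?_⟩ (hB.transversal y)
      rw [map_smul, hc, hξU y hy, smul_smul, inv_mul_cancel₀ hc0, one_smul]
  let e : EuclideanSpace ℝ (Fin n) → (y : M) → TangentSpace (𝓡 n) y := fun a ↦
    VectorField.mpullback (𝓡 n) 𝓘(ℝ, EuclideanSpace ℝ (Fin n)) p (fun _ ↦ a)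
  have hconst : ∀ (a z : EuclideanSpace ℝ (Fin n)), ContMDiffAt 𝓘(ℝ, EuclideanSpace ℝ (Fin n))
      𝓘(ℝ, EuclideanSpace ℝ (Fin n)).tangent ∞ (fun z ↦
        (⟨z, a⟩ : TangentBundle 𝓘(ℝ, EuclideanSpace ℝ (Fin n)) (EuclideanSpace ℝ (Fin n)))) z :=
    fun a z ↦ contMDiffAt_vectorSpace_iff_contDiffAt.2 contDiffAt_const
  have hes : ∀ a, ∀ y ∈ U, SmoothFieldAt (e a) y := fun a y hy ↦
    ContMDiffAt.mpullback_vectorField_preimage (hconst a (p y)) (hp y)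
      (isInvertible_mfderiv_of_injective (hinj y hy)) (by simp)
  have hpe : ∀ a, ∀ y ∈ U, mvfderiv (𝓡 n) p y (e a y) = a := fun a y hy ↦
    (isInvertible_mfderiv_of_injective (hinj y hy)).self_apply_inverse a
  have hF : ∀ a, ∀ y ∈ U, MDifferentiableAt (𝓡 n) 𝓘(ℝ, Fin (n + 1) → ℝ)
      (fun y ↦ mvfderiv (𝓡 n) φ y (e a y)) y := fun a y hy ↦
    (contMDiffAt_mvfderiv_apply hB.contMDiff (hes a y hy)).mdifferentiableAt (by simp)
  have hgauss : ∀ a, ∀ y ∈ U, ∀ v, mvfderiv (𝓡 n) (fun y ↦ mvfderiv (𝓡 n) φ y (e a y)) y v =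
      mvfderiv (𝓡 n) φ y (D (e a) y v) + g.val y v (e a y) • ξ x₀ := fun a y hy v ↦ by
    rw [hB.gauss y (e a) ((hes a y hy).mdifferentiableAt (by simp)) v, hξU y hy]
  -- The function q(dφ e_a) = a is constant and q ξ = 0, so the Gauss formula leaves dp(∇e_a) = 0,
  -- with dp injective.
  have hpar : ∀ a, ∀ y ∈ U, ∀ v, D (e a) y v = 0 := by
    intro a y hy v
    have h1 := mvfderiv_clm_comp q (hF a y hy) v
    have hev : (fun y ↦ q (mvfderiv (𝓡 n) φ y (e a y))) =ᶠ[𝓝 y] fun _ ↦ a := by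
      filter_upwards [hU.mem_nhds hy] with z hz
      rw [← hdp, hpe a z hz]
    rw [mvfderiv_congr_of_eventuallyEq hev, mvfderiv_const, hgauss a y hy, map_add, map_smul, hqξ,
      smul_zero, add_zero, ← hdp] at h1
    exact hinj y hy (h1.symm.trans (map_zero _).symm)
  refine ⟨⟨U, hU, hxU, p, hp, hinj, e, hes, hpe, hpar, fun a b y hy ↦ ?_,
    fun a y ↦ l (mvfderiv (𝓡 n) φ y (e a y)), fun a y hy ↦ ?_, fun a y hy v ↦ ?_⟩⟩
  · have := VectorField.mpullback_mlieBracket (I := 𝓡 n) (n := ∞)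
      ((hconst a (p y)).mdifferentiableAt (by simp)) ((hconst b (p y)).mdifferentiableAt (by simp))
      (hp y) (by
        rw [minSmoothness_of_isRCLikeNormedField]
        exact WithTop.coe_le_coe.2 (le_top : (2 : ℕ∞) ≤ ⊤))
    refine this.symm.trans ?_
    rw [VectorField.mpullback_apply, mlieBracket_const a b]
    exact map_zero _
  · exact l.contMDiff.contMDiffAt.comp y (contMDiffAt_mvfderiv_apply hB.contMDiff (hes a y hy))
  · rw [mvfderiv_clm_comp l (hF a y hy), hgauss a y hy, hpar a y hy, map_zero, zero_add, map_smul,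
      hlξ, smul_eq_mul, mul_one]

end ParabolicSphere

/-! ### Torsion of ∇^J and local J-holomorphic functions -/

namespace ParabolicSphere

open Filter Topology Set

variable {n : ℕ} {M : Type*} [TopologicalSpace M] [ChartedSpace (EuclideanSpace ℝ (Fin n)) M]

theorem mvfderiv_sum_mul {ι : Type*} (s : Finset ι) {c x : ι → M → ℝ} {y : M}
    (hc : ∀ i, MDifferentiableAt (𝓡 n) 𝓘(ℝ, ℝ) (c i) y)
    (hx : ∀ i, MDifferentiableAt (𝓡 n) 𝓘(ℝ, ℝ) (x i) y) (v : TangentSpace (𝓡 n) y) :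
    mvfderiv (𝓡 n) (fun z ↦ ∑ i ∈ s, c i z * x i z) y v =
      ∑ i ∈ s, (c i y * mvfderiv (𝓡 n) (x i) y v + x i y * mvfderiv (𝓡 n) (c i) y v) := by
  classical
  have hm : ∀ i, MDifferentiableAt (𝓡 n) 𝓘(ℝ, ℝ) (fun z ↦ c i z * x i z) y := fun i ↦
    (hc i).mul (hx i)
  have key : MDifferentiableAt (𝓡 n) 𝓘(ℝ, ℝ) (fun z ↦ ∑ i ∈ s, c i z * x i z) y ∧
      mvfderiv (𝓡 n) (fun z ↦ ∑ i ∈ s, c i z * x i z) y v =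
      ∑ i ∈ s, (c i y * mvfderiv (𝓡 n) (x i) y v + x i y * mvfderiv (𝓡 n) (c i) y v) := by
    induction s using Finset.induction_on with
    | empty => simp [mdifferentiableAt_const, mvfderiv_const]
    | insert i s hi ih =>
      simp only [Finset.sum_insert hi]
      refine ⟨(hm i).add ih.1, ?_⟩
      have h1 := mvfderiv_add (hm i) ih.1
      have h2 := mvfderiv_mul (hc i) (hx i)
      have h3 := congr($h1 v)
      have h4 := congr($h2 v)
      rw [add_apply, ih.2] at h3
      refine h3.trans ?_
      congr 1
  exact key.2

variable [IsManifold (𝓡 n) ∞ M]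

theorem PseudoRiemannianMetric.contMDiffAt_apply (g : PseudoRiemannianMetric n M)
    {Y Z : (y : M) → TangentSpace (𝓡 n) y} {x : M} (hY : SmoothFieldAt Y x)
    (hZ : SmoothFieldAt Z x) :
    ContMDiffAt (𝓡 n) 𝓘(ℝ, ℝ) ∞ (fun y ↦ g.val y (Y y) (Z y)) x := by
  have : ContMDiffAt (𝓡 n) ((𝓡 n).prod 𝓘(ℝ, ℝ)) ∞
      (fun y ↦ TotalSpace.mk' ℝ (E := Bundle.Trivial M ℝ) y (g.val y (Y y) (Z y))) x :=
    ContMDiffAt.clm_bundle_apply₂ (F₁ := EuclideanSpace ℝ (Fin n))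
      (F₂ := EuclideanSpace ℝ (Fin n)) (g.contMDiff x) hY hZ
  simp only [contMDiffAt_totalSpace] at this
  exact this.2

theorem AlmostComplexStructure.smoothFieldAt (J : AlmostComplexStructure n M)
    {Y : (y : M) → TangentSpace (𝓡 n) y} {x : M} (hY : SmoothFieldAt Y x) :
    SmoothFieldAt (fun y ↦ J.val y (Y y)) x :=
  ContMDiffAt.clm_bundle_apply (J.contMDiff x) hY

/-- The Lie derivatives of a function along commuting vector fields commute. -/
theorem mvfderiv_comm_of_mlieBracket_eq_zero {X Y Z : (y : M) → TangentSpace (𝓡 n) y} {x : M}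
    {f fX fY : M → ℝ} (hX : SmoothFieldAt X x) (hY : SmoothFieldAt Y x) (hZ : SmoothFieldAt Z x)
    (hZx : Z x ≠ 0) (hXY : ∀ᶠ y in 𝓝 x, VectorField.mlieBracket (𝓡 n) X Y y = 0)
    (hXZ : ∀ᶠ y in 𝓝 x, VectorField.mlieBracket (𝓡 n) X Z y = 0)
    (hYZ : ∀ᶠ y in 𝓝 x, VectorField.mlieBracket (𝓡 n) Y Z y = 0)
    (hf : ContMDiffAt (𝓡 n) 𝓘(ℝ, ℝ) ∞ f x)
    (hfX : MDifferentiableAt (𝓡 n) 𝓘(ℝ, ℝ) fX x) (hfY : MDifferentiableAt (𝓡 n) 𝓘(ℝ, ℝ) fY x)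
    (hfX' : ∀ᶠ y in 𝓝 x, mvfderiv (𝓡 n) f y (X y) = fX y)
    (hfY' : ∀ᶠ y in 𝓝 x, mvfderiv (𝓡 n) f y (Y y) = fY y) :
    mvfderiv (𝓡 n) fY x (X x) = mvfderiv (𝓡 n) fX x (Y x) := by
  have hM3 : IsManifold (𝓡 n) (minSmoothness ℝ 3) M := by
    rw [minSmoothness_of_isRCLikeNormedField]
    infer_instance
  have hle : minSmoothness ℝ 2 ≤ ∞ := by
    rw [minSmoothness_of_isRCLikeNormedField]
    exact WithTop.coe_le_coe.2 (le_top : (2 : ℕ∞) ≤ ⊤)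
  have hfd : ∀ᶠ y in 𝓝 x, MDifferentiableAt (𝓡 n) 𝓘(ℝ, ℝ) f y := by
    filter_upwards [(contMDiffAt_iff_contMDiffAt_nhds (by simp)).1 (hf.of_le (m := 1) (by simp))] with y hy
      using hy.mdifferentiableAt (by simp)
  have hZd : ∀ᶠ y in 𝓝 x, DiffFieldAt Z y := by
    filter_upwards [(contMDiffAt_iff_contMDiffAt_nhds (by simp)).1 (hZ.of_le (m := 1) (by simp))] with y hy
      using hy.mdifferentiableAt (by simp)
  have hbr : ∀ {W : (y : M) → TangentSpace (𝓡 n) y} {fW : M → ℝ},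
      (∀ᶠ y in 𝓝 x, VectorField.mlieBracket (𝓡 n) W Z y = 0) →
      (∀ᶠ y in 𝓝 x, mvfderiv (𝓡 n) f y (W y) = fW y) →
      VectorField.mlieBracket (𝓡 n) W (f • Z) =ᶠ[𝓝 x] fW • Z := by
    intro W fW hW hfW
    filter_upwards [hfd, hZd, hW, hfW] with y h1 h2 h3 h4
    rw [VectorField.mlieBracket_smul_right h1 h2, h3, h4, smul_zero, add_zero]
    rfl
  have hZ0 : DiffFieldAt Z x := hZ.mdifferentiableAt (by simp)
  -- Since Z commutes with X and Y, [X, [Y, fZ]] = X(Yf) Z and [Y, [X, fZ]] = Y(Xf) Z; the Jacobi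
  -- identity with [X, Y] = 0 equates them, and Z x ≠ 0 can be cancelled.
  have jac := VectorField.leibniz_identity_mlieBracket_apply (I := 𝓡 n) (U := X) (V := Y)
    (W := f • Z) (x := x) (hX.of_le hle) (hY.of_le hle) ((hf.smul_section hZ).of_le hle)
  have hXY0 : VectorField.mlieBracket (𝓡 n) (VectorField.mlieBracket (𝓡 n) X Y) (f • Z) x = 0 := by
    have h0 : VectorField.mlieBracket (𝓡 n) X Y =ᶠ[𝓝 x] 0 := hXY
    have h1 := h0.mlieBracket_vectorField_eq (EventuallyEq.refl (𝓝 x) (f • Z))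
    exact h1.trans (congrFun VectorField.mlieBracket_zero_left x)
  rw [EventuallyEq.rfl.mlieBracket_vectorField_eq (hbr hYZ hfY'),
    EventuallyEq.rfl.mlieBracket_vectorField_eq (hbr hXZ hfX'),
    hXY0, VectorField.mlieBracket_smul_right hfY hZ0,
    VectorField.mlieBracket_smul_right hfX hZ0,
    hXZ.self_of_nhds, hYZ.self_of_nhds] at jac
  simp only [smul_zero, add_zero, zero_add] at jac
  exact smul_left_injective ℝ hZx jac

variable {D : AffineConnection n M} {g : PseudoRiemannianMetric n M} {x₀ : M}

namespace HessianFrame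

variable (H : HessianFrame D g x₀)

theorem field_coord {y : M} (hy : y ∈ H.domain) (w : TangentSpace (𝓡 n) y) :
    H.field (mvfderiv (𝓡 n) H.coord y w) y = w :=
  H.injective_coord y hy (H.coord_field _ y hy)

theorem sum_coord_smul_field {y : M} (hy : y ∈ H.domain) (w : TangentSpace (𝓡 n) y) :
    ∑ i, (mvfderiv (𝓡 n) H.coord y w) i • H.field (EuclideanSpace.basisFun (Fin n) ℝ i) y = w := by
  apply H.injective_coord y hy
  rw [map_sum]
  simp only [map_smul, H.coord_field _ y hy]
  exact (EuclideanSpace.basisFun (Fin n) ℝ).sum_repr (mvfderiv (𝓡 n) H.coord y w)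

/-- Total symmetry of ∇g: g(e_b, e_c) is the derivative along e_b of the potential of e_c, so both
sides are mixed second derivatives of that potential. -/
theorem mvfderiv_metric_field_comm {y : M} (hy : y ∈ H.domain) (a b c : EuclideanSpace ℝ (Fin n)) :
    mvfderiv (𝓡 n) (fun z ↦ g.val z (H.field b z) (H.field c z)) y (H.field a y) =
      mvfderiv (𝓡 n) (fun z ↦ g.val z (H.field a z) (H.field c z)) y (H.field b y) := by
  -- In dimension 0 there is no nonvanishing auxiliary field to commute with.
  rcases subsingleton_or_nontrivial (EuclideanSpace ℝ (Fin n)) with hs | hs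
  · rw [Subsingleton.elim a b]
  obtain ⟨d, hd⟩ := exists_ne (0 : EuclideanSpace ℝ (Fin n))
  have hU := H.isOpen_domain.mem_nhds hy
  have hbr : ∀ a b, ∀ᶠ z in 𝓝 y, VectorField.mlieBracket (𝓡 n) (H.field a) (H.field b) z = 0 :=
    fun a b ↦ by filter_upwards [hU] with z hz using H.mlieBracket_field a b z hz
  have hg : ∀ a, MDifferentiableAt (𝓡 n) 𝓘(ℝ, ℝ)
      (fun z ↦ g.val z (H.field a z) (H.field c z)) y := fun a ↦
    (g.contMDiffAt_apply (H.smooth_field a y hy) (H.smooth_field c y hy)).mdifferentiableAt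
      (by simp)
  have hpot : ∀ a, ∀ᶠ z in 𝓝 y, mvfderiv (𝓡 n) (H.potential c) z (H.field a z) =
      g.val z (H.field a z) (H.field c z) := fun a ↦ by
    filter_upwards [hU] with z hz using H.mvfderiv_potential c z hz _
  refine mvfderiv_comm_of_mlieBracket_eq_zero (H.smooth_field a y hy) (H.smooth_field b y hy)
    (H.smooth_field d y hy) (fun h0 ↦ hd ?_) (hbr a b) (hbr a d) (hbr b d)
    (H.contMDiffAt_potential c y hy) (hg a) (hg b) (hpot a) (hpot b)
  rw [← H.coord_field d y hy, h0, map_zero]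

variable (J : AlmostComplexStructure n M)

/-- Parallelism of ω applied to J⁻¹e_b and the parallel field e_c, with ω(J⁻¹e_b, e_c) = g(e_b,
e_c). The left side is g(∇^J_v e_b, e_c). -/
theorem fundamentalForm_invField_field (hω : IsParallelForm D (fundamentalForm g J)) {y : M}
    (hy : y ∈ H.domain) (b c : EuclideanSpace ℝ (Fin n)) (v : TangentSpace (𝓡 n) y) :
    fundamentalForm g J y (D (J.invField (H.field b)) y v) (H.field c y) =
      mvfderiv (𝓡 n) (fun z ↦ g.val z (H.field b z) (H.field c z)) y v := by
  have hd : ∀ a, DiffFieldAt (H.field a) y := fun a ↦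
    (H.smooth_field a y hy).mdifferentiableAt (by simp)
  have h := hω y (J.invField (H.field b)) (H.field c)
    (mdifferentiableAt_neg_section (J.mdifferentiableAt (hd b))) (hd c) v
  rw [H.parallel_field c y hy, map_zero, add_zero] at h
  rw [← h]
  congr 2
  funext z
  simp [fundamentalForm, AlmostComplexStructure.invField, J.sq_eq_neg]

theorem torsion_conjConnection (hω : IsParallelForm D (fundamentalForm g J)) {y : M}
    (hy : y ∈ H.domain) : (conjConnection J D).torsion y = 0 := by
  ext v w : 2
  rw [← H.field_coord hy v, ← H.field_coord hy w]
  set a := mvfderiv (𝓡 n) H.coord y v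
  set b := mvfderiv (𝓡 n) H.coord y w
  have hd : ∀ a, DiffFieldAt (H.field a) y := fun a ↦
    (H.smooth_field a y hy).mdifferentiableAt (by simp)
  rw [CovariantDerivative.torsion_apply _ (hd a) (hd b), H.mlieBracket_field a b y hy, sub_zero]
  refine g.nondegenerate y _ fun u ↦ ?_
  rw [← H.field_coord hy u, map_sub, sub_apply, sub_eq_zero]
  set c := mvfderiv (𝓡 n) H.coord y u
  exact (H.fundamentalForm_invField_field J hω hy b c (H.field a y)).trans
    ((H.mvfderiv_metric_field_comm hy a b c).trans
      (H.fundamentalForm_invField_field J hω hy a c (H.field b y)).symm)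

theorem mvfderiv_fundamentalForm_field (hω : IsParallelForm D (fundamentalForm g J)) {y : M}
    (hy : y ∈ H.domain) (a b : EuclideanSpace ℝ (Fin n)) (v : TangentSpace (𝓡 n) y) :
    mvfderiv (𝓡 n) (fun z ↦ fundamentalForm g J z (H.field a z) (H.field b z)) y v = 0 := by
  have hd : ∀ a, DiffFieldAt (H.field a) y := fun a ↦
    (H.smooth_field a y hy).mdifferentiableAt (by simp)
  have h := hω y (H.field a) (H.field b) (hd a) (hd b) v
  rw [H.parallel_field a y hy, H.parallel_field b y hy] at h
  simpa using h

/-- Near `x₀` there is a smooth immersion into `ℂ^n` whose differential intertwines `J` and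
multiplication by `i`. -/
theorem exists_holomorphic_immersion (hω : IsParallelForm D (fundamentalForm g J)) :
    ∃ h : M → Fin n → ℂ, ∀ y ∈ H.domain, ContMDiffAt (𝓡 n) 𝓘(ℝ, Fin n → ℂ) ∞ h y ∧
      Function.Injective (mvfderiv (𝓡 n) h y) ∧
      ∀ v, mvfderiv (𝓡 n) h y (J.val y v) = Complex.I • mvfderiv (𝓡 n) h y v := by
  let b : Fin n → EuclideanSpace ℝ (Fin n) := fun i ↦ EuclideanSpace.basisFun (Fin n) ℝ i
  let c : Fin n → Fin n → M → ℝ := fun j i z ↦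
    fundamentalForm g J z (H.field (b i) z) (H.field (b j) z)
  -- A primitive of ω(·, e_j): the coefficients ω(e_i, e_j) have zero derivative, so only the
  -- differentials of the coordinates contribute.
  let r : Fin n → M → ℝ := fun j z ↦ ∑ i, c j i z * H.coord z i
  have hc : ∀ j i, ∀ y ∈ H.domain, ContMDiffAt (𝓡 n) 𝓘(ℝ, ℝ) ∞ (c j i) y := fun j i y hy ↦
    g.contMDiffAt_apply (J.smoothFieldAt (H.smooth_field (b i) y hy)) (H.smooth_field (b j) y hy)
  have hx : ∀ i y, ContMDiffAt (𝓡 n) 𝓘(ℝ, ℝ) ∞ (fun z ↦ H.coord z i) y := fun i y ↦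
    (EuclideanSpace.proj (𝕜 := ℝ) i).contMDiff.contMDiffAt.comp y (H.contMDiff_coord y)
  have hr : ∀ j, ∀ y ∈ H.domain, ContMDiffAt (𝓡 n) 𝓘(ℝ, ℝ) ∞ (r j) y := fun j y hy ↦
    contMDiffAt_finsetSum fun i _ ↦ (hc j i y hy).mul (hx i y)
  have hdr : ∀ j, ∀ y ∈ H.domain, ∀ v,
      mvfderiv (𝓡 n) (r j) y v = fundamentalForm g J y v (H.field (b j) y) := by
    intro j y hy v
    have h1 := mvfderiv_sum_mul Finset.univ (fun i ↦ (hc j i y hy).mdifferentiableAt (by simp))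
      (fun i ↦ (hx i y).mdifferentiableAt (by simp)) v
    have h2 : ∀ i, mvfderiv (𝓡 n) (c j i) y v = 0 := fun i ↦
      H.mvfderiv_fundamentalForm_field J hω hy (b i) (b j) v
    have h3 : ∀ i, mvfderiv (𝓡 n) (fun z ↦ H.coord z i) y v = mvfderiv (𝓡 n) H.coord y v i :=
      fun i ↦ mvfderiv_clm_comp (EuclideanSpace.proj (𝕜 := ℝ) i)
        ((H.contMDiff_coord y).mdifferentiableAt (by simp)) v
    refine h1.trans ?_
    conv_rhs => rw [← H.sum_coord_smul_field hy v]
    rw [map_sum, sum_apply]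
    refine Finset.sum_congr rfl fun i _ ↦ ?_
    rw [h2, h3, mul_zero, add_zero, map_smul, smul_apply, smul_eq_mul, mul_comm]
  have hmr : ∀ j, ∀ y ∈ H.domain, MDifferentiableAt (𝓡 n) 𝓘(ℝ, ℝ) (r j) y := fun j y hy ↦
    (hr j y hy).mdifferentiableAt (by simp)
  have hmp : ∀ a, ∀ y ∈ H.domain, MDifferentiableAt (𝓡 n) 𝓘(ℝ, ℝ) (H.potential a) y :=
    fun a y hy ↦ (H.contMDiffAt_potential a y hy).mdifferentiableAt (by simp)
  let ι : ℝ →L[ℝ] ℂ := Complex.ofRealCLM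
  let ι' : ℝ →L[ℝ] ℂ := Complex.I • Complex.ofRealCLM
  -- Real and imaginary parts are primitives of g(J·, e_j) and g(·, e_j); replacing v by Jv
  -- multiplies the differential by i.
  let h : M → Fin n → ℂ := fun z j ↦ ι (r j z) + ι' (H.potential (b j) z)
  have hh : ∀ y ∈ H.domain, ContMDiffAt (𝓡 n) 𝓘(ℝ, Fin n → ℂ) ∞ h y := fun y hy ↦
    contMDiffAt_pi_space.2 fun j ↦ (ι.contMDiff.contMDiffAt.comp y (hr j y hy)).add
      (ι'.contMDiff.contMDiffAt.comp y (H.contMDiffAt_potential (b j) y hy))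
  have hdh : ∀ y ∈ H.domain, ∀ v j, mvfderiv (𝓡 n) h y v j =
      (fundamentalForm g J y v (H.field (b j) y) : ℂ) +
        Complex.I * (g.val y v (H.field (b j) y) : ℂ) := by
    intro y hy v j
    rw [mvfderiv_pi_apply ((hh y hy).mdifferentiableAt (by simp))]
    have h1 := mvfderiv_add (ι.contMDiff.mdifferentiableAt (n := ∞) (by simp) |>.comp y (hmr j y hy))
      (ι'.contMDiff.mdifferentiableAt (n := ∞) (by simp) |>.comp y (hmp (b j) y hy))
    have h2 := congr($h1 v)
    refine h2.trans ?_
    have h3 := mvfderiv_clm_comp ι (hmr j y hy) v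
    have h4 := mvfderiv_clm_comp ι' (hmp (b j) y hy) v
    rw [hdr j y hy] at h3
    rw [H.mvfderiv_potential (b j) y hy] at h4
    exact congrArg₂ (· + ·) h3 h4
  refine ⟨h, fun y hy ↦ ⟨hh y hy, ?_, fun v ↦ ?_⟩⟩
  -- The imaginary parts already give injectivity, by nondegeneracy of g.
  · rw [injective_iff_map_eq_zero]
    intro v hv
    refine g.nondegenerate y v fun w ↦ ?_
    have hz : ∀ j, g.val y v (H.field (b j) y) = 0 := by
      intro j
      have := congrArg Complex.im ((hdh y hy v j).symm.trans (congrFun hv j))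
      simpa using this
    rw [← H.sum_coord_smul_field hy w, map_sum]
    refine Finset.sum_eq_zero fun i _ ↦ ?_
    rw [map_smul, hz i, smul_zero]
  · ext j
    rw [Pi.smul_apply, hdh y hy, hdh y hy]
    have h1 : fundamentalForm g J y (J.val y v) (H.field (b j) y) =
        -g.val y v (H.field (b j) y) := by
      simp [fundamentalForm, J.sq_eq_neg]
    have h2 : g.val y (J.val y v) (H.field (b j) y) =
        fundamentalForm g J y v (H.field (b j) y) := rfl
    rw [h1, h2, smul_eq_mul, mul_add, ← mul_assoc, Complex.I_mul_I]
    push_cast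
    ring

end HessianFrame

end ParabolicSphere

/-! ### Holomorphic charts and their transition maps -/

namespace ParabolicSphere

open Filter Topology Set

section Charts

variable {n : ℕ} {M : Type*} [TopologicalSpace M] [ChartedSpace (EuclideanSpace ℝ (Fin n)) M]

/-- An injective linear map into `ℂ^n` from a real space of dimension `n` on which `J` acts as
multiplication by `i` becomes bijective after composition with a suitable projection. -/
theorem exists_bijective_comp {J : EuclideanSpace ℝ (Fin n) →L[ℝ] EuclideanSpace ℝ (Fin n)}
    {A : EuclideanSpace ℝ (Fin n) →L[ℝ] (Fin n → ℂ)} (hA : Function.Injective A)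
    (hJ : ∀ v, A (J v) = Complex.I • A v) :
    ∃ P : (Fin n → ℂ) →L[ℂ] EuclideanSpace ℂ (Fin (n / 2)), Function.Bijective fun v ↦ P (A v) := by
  let W : Submodule ℂ (Fin n → ℂ) :=
    { carrier := Set.range A
      add_mem' := by
        rintro _ _ ⟨v, rfl⟩ ⟨w, rfl⟩
        exact ⟨v + w, map_add A v w⟩
      zero_mem' := ⟨0, map_zero A⟩
      smul_mem' := by
        rintro c _ ⟨v, rfl⟩
        refine ⟨c.re • v + c.im • J v, ?_⟩
        rw [map_add, map_smul, map_smul, hJ]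
        ext i
        have := Complex.re_add_im c
        simp only [Pi.add_apply, Pi.smul_apply, Complex.real_smul, smul_eq_mul]
        conv_rhs => rw [← this]
        ring }
  let B₀ : EuclideanSpace ℝ (Fin n) →ₗ[ℝ] W :=
    { toFun := fun v ↦ ⟨A v, v, rfl⟩
      map_add' := fun v w ↦ Subtype.ext (map_add A v w)
      map_smul' := fun c v ↦ Subtype.ext (map_smul A c v) }
  let B : EuclideanSpace ℝ (Fin n) ≃ₗ[ℝ] W := LinearEquiv.ofBijective B₀
    ⟨fun v w h ↦ hA (congrArg Subtype.val h), fun ⟨_, v, hv⟩ ↦ ⟨v, Subtype.ext hv⟩⟩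
  -- The real dimension n of W is twice its complex dimension, so n is even and the division n / 2
  -- is exact.
  have hW : Module.finrank ℂ W = Module.finrank ℂ (EuclideanSpace ℂ (Fin (n / 2))) := by
    have h1 := finrank_real_of_complex W
    have h2 := B.finrank_eq
    rw [finrank_euclideanSpace_fin] at h2 ⊢
    omega
  let C : W ≃ₗ[ℂ] EuclideanSpace ℂ (Fin (n / 2)) := LinearEquiv.ofFinrankEq _ _ hW
  obtain ⟨P, hP⟩ := C.toLinearMap.exists_extend
  refine ⟨P.toContinuousLinearMap, ?_⟩
  have h : (fun v ↦ P.toContinuousLinearMap (A v)) = C ∘ B := by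
    funext v
    exact congr($hP (B v))
  rw [h]
  exact C.bijective.comp B.bijective

variable [IsManifold (𝓡 n) ∞ M] {F : Type*} [NormedAddCommGroup F] [NormedSpace ℝ F]

/-- The inverse function theorem for a map from a manifold to a vector space. -/
theorem exists_openPartialHomeomorph_of_bijective {Φ : M → F} {U : Set M} (hU : IsOpen U)
    (hΦ : ∀ y ∈ U, ContMDiffAt (𝓡 n) 𝓘(ℝ, F) ∞ Φ y) {x : M} (hx : x ∈ U)
    (hb : Function.Bijective (mvfderiv (𝓡 n) Φ x)) :
    ∃ e : OpenPartialHomeomorph M F, x ∈ e.source ∧ e.source ⊆ U ∧ EqOn e Φ e.source ∧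
      ContMDiffOn 𝓘(ℝ, F) (𝓡 n) ∞ e.symm e.target := by
  set E := EuclideanSpace ℝ (Fin n)
  let c := chartAt E x
  let f : E → F := Φ ∘ c.symm
  let O : Set E := c.target ∩ c.symm ⁻¹' U
  have hO : IsOpen O := c.symm.isOpen_inter_preimage hU
  have hxc : x ∈ c.source := mem_chart_source E x
  have hcx : c.symm (c x) = x := c.left_inv hxc
  have hxO : c x ∈ O := ⟨c.map_source hxc, by rwa [mem_preimage, hcx]⟩
  have hf : ∀ z ∈ O, ContDiffAt ℝ ∞ f z := fun z hz ↦ by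
    refine ContMDiffAt.contDiffAt ((hΦ _ hz.2).comp z ?_)
    exact (contMDiffOn_chart_symm (x := x)).contMDiffAt (c.open_target.mem_nhds hz.1)
  have hc : c.MDifferentiable (𝓡 n) (𝓡 n) := mdifferentiable_chart x
  have hfb : Function.Bijective (fderiv ℝ f (c x)) := by
    have h1 : mfderiv (𝓡 n) 𝓘(ℝ, F) f (c x) =
        (mfderiv (𝓡 n) 𝓘(ℝ, F) Φ (c.symm (c x))).comp (mfderiv (𝓡 n) (𝓡 n) c.symm (c x)) :=
      mfderiv_comp (c x) (by rw [hcx]; exact (hΦ x hx).mdifferentiableAt (by simp))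
        (hc.mdifferentiableAt_symm (c.map_source hxc))
    have h2 := hc.symm.mfderiv_bijective (c.map_source hxc)
    rw [← mfderiv_eq_fderiv]
    have h3 : Function.Bijective (mfderiv (𝓡 n) 𝓘(ℝ, F) Φ (c.symm (c x))) := by
      rw [hcx]; exact hb
    have h4 := h3.comp h2
    rw [← ContinuousLinearMap.coe_comp, ← h1] at h4
    exact h4
  let f' : E ≃L[ℝ] F := (LinearEquiv.ofBijective (fderiv ℝ f (c x)).toLinearMap hfb).toContinuousLinearEquiv
  have hf' : HasFDerivAt f (f' : E →L[ℝ] F) (c x) :=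
    ((hf _ hxO).differentiableAt (by simp)).hasFDerivAt
  let R := (hf _ hxO).toOpenPartialHomeomorph f hf' (by simp)
  -- Restricting to the open set where the derivative is invertible makes the inverse smooth on the
  -- whole target, not only at the image of x.
  let V : Set E := O ∩ fderiv ℝ f ⁻¹' range ((↑) : (E ≃L[ℝ] F) → (E →L[ℝ] F))
  have hV : IsOpen V := by
    refine ContinuousOn.isOpen_inter_preimage (fun z hz ↦ ?_) hO ContinuousLinearEquiv.isOpen
    exact ((hf z hz).fderiv_right (m := 0) (by simp)).continuousAt.continuousWithinAt
  have hxV : c x ∈ V := ⟨hxO, f', hf'.fderiv.symm⟩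
  let R' := R.restrOpen V hV
  refine ⟨c.trans R', ?_, ?_, ?_, ?_⟩
  · exact ⟨hxc, (hf _ hxO).mem_toOpenPartialHomeomorph_source hf' (by simp), hxV⟩
  · rintro y ⟨hy1, hy2, hy3⟩
    have : c.symm (c y) ∈ U := hy3.1.2
    rwa [c.left_inv hy1] at this
  · rintro y ⟨hy1, hy2⟩
    change Φ (c.symm (c y)) = Φ y
    rw [c.left_inv hy1]
  · intro w hw
    have hw1 : w ∈ R'.target := hw.1
    have hw2 : R'.symm w ∈ c.target := hw.2
    have hz : R.symm w ∈ V := (R'.map_target hw1).2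
    obtain ⟨L, hL⟩ := hz.2
    have hwR : w ∈ R.target := hw1.1
    have hR : ContDiffAt ℝ ∞ R.symm w := R.contDiffAt_symm (f₀' := L) hwR
      (by rw [hL]; exact ((hf _ hz.1).differentiableAt (by simp)).hasFDerivAt) (hf _ hz.1)
    refine ContMDiffAt.contMDiffWithinAt ?_
    refine ContMDiffAt.comp w (I' := 𝓡 n) (g := c.symm) (f := R.symm) ?_ hR.contMDiffAt
    exact (contMDiffOn_chart_symm (x := x)).contMDiffAt (c.open_target.mem_nhds hw2)

end Charts

variable {n : ℕ} {M : Type*} [TopologicalSpace M] [ChartedSpace (EuclideanSpace ℝ (Fin n)) M]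
  [IsManifold (𝓡 n) ∞ M] {D : AffineConnection n M} {g : PseudoRiemannianMetric n M}

/-- A complex-linear projection of the holomorphic immersion, bijective on tangent vectors at x,
still intertwines J and i nearby; the inverse function theorem makes it a chart. -/
theorem HessianFrame.exists_isHolomorphicChart {x : M} (H : HessianFrame D g x)
    (J : AlmostComplexStructure n M) (hω : IsParallelForm D (fundamentalForm g J)) :
    ∃ e : OpenPartialHomeomorph M (EuclideanSpace ℂ (Fin (n / 2))),
      x ∈ e.source ∧ IsHolomorphicChart J e := by
  obtain ⟨h, hh⟩ := H.exists_holomorphic_immersion J hω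
  obtain ⟨-, h2, h3⟩ := hh x H.mem_domain
  obtain ⟨P, hP⟩ := exists_bijective_comp (J := J.val x) (A := mvfderiv (𝓡 n) h x) h2 h3
  let P' : (Fin n → ℂ) →L[ℝ] EuclideanSpace ℂ (Fin (n / 2)) := P.restrictScalars ℝ
  have hd : ∀ y ∈ H.domain, ∀ v, mvfderiv (𝓡 n) (fun z ↦ P' (h z)) y v =
      P (mvfderiv (𝓡 n) h y v) := fun y hy v ↦
    mvfderiv_clm_comp P' ((hh y hy).1.mdifferentiableAt (by simp)) v
  have hs : ∀ y ∈ H.domain, ContMDiffAt (𝓡 n) 𝓘(ℝ, EuclideanSpace ℂ (Fin (n / 2))) ∞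
      (fun z ↦ P' (h z)) y := fun y hy ↦ P'.contMDiff.contMDiffAt.comp y (hh y hy).1
  obtain ⟨e, hxe, heU, he, hes⟩ := exists_openPartialHomeomorph_of_bijective H.isOpen_domain hs
    H.mem_domain (by rw [funext (hd x H.mem_domain)]; exact hP)
  refine ⟨e, hxe, ⟨fun y hy ↦ ?_, hes, fun y hy v ↦ ?_⟩⟩
  · exact (hs y (heU hy)).contMDiffWithinAt.congr (fun z hz ↦ he hz) (he hy)
  · have hev : (e : M → _) =ᶠ[𝓝 y] fun z ↦ P' (h z) :=
      he.eventuallyEq_of_mem (e.open_source.mem_nhds hy)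
    rw [mvfderiv_congr_of_eventuallyEq hev, mvfderiv_congr_of_eventuallyEq hev,
      hd y (heU hy), hd y (heU hy), (hh y (heU hy)).2.2, map_smul]

namespace IsHolomorphicChart

variable {J : AlmostComplexStructure n M} {m : ℕ}
  {e e' : OpenPartialHomeomorph M (EuclideanSpace ℂ (Fin m))}

theorem mdifferentiable (he : IsHolomorphicChart J e) :
    e.MDifferentiable (𝓡 n) 𝓘(ℝ, EuclideanSpace ℂ (Fin m)) :=
  ⟨he.contMDiffOn.mdifferentiableOn (by simp), he.contMDiffOn_symm.mdifferentiableOn (by simp)⟩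

theorem mfderiv_symm_smul_I (he : IsHolomorphicChart J e) {z : EuclideanSpace ℂ (Fin m)}
    (hz : z ∈ e.target) (w : EuclideanSpace ℂ (Fin m)) :
    mfderiv 𝓘(ℝ, EuclideanSpace ℂ (Fin m)) (𝓡 n) e.symm z (Complex.I • w : EuclideanSpace ℂ (Fin m)) =
      J.val (e.symm z) (mfderiv 𝓘(ℝ, EuclideanSpace ℂ (Fin m)) (𝓡 n) e.symm z w) := by
  have hd := he.mdifferentiable
  apply hd.mfderiv_injective (e.map_target hz)
  have h1 : ∀ w : EuclideanSpace ℂ (Fin m), mvfderiv (𝓡 n) e (e.symm z)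
      (mfderiv 𝓘(ℝ, EuclideanSpace ℂ (Fin m)) (𝓡 n) e.symm z w) = w := fun w ↦
    congr($(hd.comp_symm_deriv hz) w)
  refine (h1 _).trans (Eq.trans ?_ (he.map_J _ (e.map_target hz) _).symm)
  rw [h1 w]

/-- The differentials of e⁻¹ and e' intertwine i with J and J with i, so that of the composite
commutes with i. The transition map is therefore complex differentiable, hence analytic. -/
theorem contDiffOn_transition (he : IsHolomorphicChart J e) (he' : IsHolomorphicChart J e') :
    ContDiffOn ℂ ω (e' ∘ e.symm) (e.symm ≫ₕ e').source := by
  have hsm : ∀ z ∈ (e.symm ≫ₕ e').source, ContMDiffAt 𝓘(ℝ, EuclideanSpace ℂ (Fin m)) (𝓡 n) ∞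
      e.symm z := fun z hz ↦ he.contMDiffOn_symm.contMDiffAt (e.open_target.mem_nhds hz.1)
  have hsm' : ∀ z ∈ (e.symm ≫ₕ e').source, ContMDiffAt (𝓡 n) 𝓘(ℝ, EuclideanSpace ℂ (Fin m)) ∞
      e' (e.symm z) := fun z hz ↦ he'.contMDiffOn.contMDiffAt (e'.open_source.mem_nhds hz.2)
  have hr : ∀ z ∈ (e.symm ≫ₕ e').source, ContDiffAt ℝ ∞ (e' ∘ e.symm) z := fun z hz ↦
    ((hsm' z hz).comp z (hsm z hz)).contDiffAt
  refine contDiffOn_omega_of_real (e.symm ≫ₕ e').open_source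
    (fun z hz ↦ (hr z hz).contDiffWithinAt) fun z hz ↦ ?_
  have hd := (hr z hz).differentiableAt (by simp)
  have hI : ∀ w, fderiv ℝ (e' ∘ e.symm) z (Complex.I • w) =
      Complex.I • fderiv ℝ (e' ∘ e.symm) z w := by
    have h1 : ∀ w : EuclideanSpace ℂ (Fin m), fderiv ℝ (e' ∘ e.symm) z w =
        mvfderiv (𝓡 n) e' (e.symm z)
          (mfderiv 𝓘(ℝ, EuclideanSpace ℂ (Fin m)) (𝓡 n) e.symm z w) := fun w ↦ by
      rw [← mfderiv_eq_fderiv]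
      exact mfderiv_comp_apply z ((hsm' z hz).mdifferentiableAt (by simp))
        ((hsm z hz).mdifferentiableAt (by simp)) w
    intro w
    rw [h1, h1, he.mfderiv_symm_smul_I hz.1]
    exact he'.map_J _ hz.2 _
  refine DifferentiableAt.differentiableWithinAt
    ((differentiableAt_iff_restrictScalars ℝ hd).2 ⟨
      { toFun := fderiv ℝ (e' ∘ e.symm) z
        map_add' := map_add _
        map_smul' := fun c w ↦ ?_
        cont := (fderiv ℝ (e' ∘ e.symm) z).cont }, rfl⟩)
  rw [← Complex.re_add_im c, add_smul, map_add, mul_comm, mul_smul, hI, Complex.coe_smul,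
    Complex.coe_smul, map_smul, map_smul, RingHom.id_apply, add_smul, mul_smul, Complex.coe_smul,
    Complex.coe_smul]

end IsHolomorphicChart

theorem isIntegrable_of_forall_exists_isHolomorphicChart {J : AlmostComplexStructure n M} {m : ℕ}
    (h : ∀ x, ∃ e : OpenPartialHomeomorph M (EuclideanSpace ℂ (Fin m)),
      x ∈ e.source ∧ IsHolomorphicChart J e) : IsIntegrable J := by
  choose c hc hJ using h
  let C : ChartedSpace (EuclideanSpace ℂ (Fin m)) M :=
    -- All holomorphic charts of the given dimension are taken at once, since any two of them are
    -- compatible.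
    { atlas := {e | IsHolomorphicChart J e}
      chartAt := c
      mem_chart_source := hc
      chart_mem_atlas := hJ }
  refine ⟨m, C, isManifold_of_contDiffOn _ _ _ fun e e' he he' ↦ ?_, fun e he ↦ he⟩
  have := IsHolomorphicChart.contDiffOn_transition (J := J) he he'
  simpa using this

end ParabolicSphere

theorem lemma3p5 {n : ℕ} {M : Type*} [TopologicalSpace M] [T2Space M]
    [ChartedSpace (EuclideanSpace ℝ (Fin n)) M] [IsManifold (𝓡 n) ∞ M]
    (D : ParabolicSphere.AffineConnection n M) [CovariantDerivative.ContMDiffCovariantDerivative D ∞]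
    (g : ParabolicSphere.PseudoRiemannianMetric n M)
    (J : ParabolicSphere.AlmostComplexStructure n M)
    (h : ParabolicSphere.IsSpecialParabolicSphere D g J) :
    ParabolicSphere.IsIntegrable J ∧ (ParabolicSphere.conjConnection J D).torsion = 0 := by
  obtain ⟨φ, ξ, hφ⟩ := h.parabolic
  have H := fun x : M ↦ (hφ.nonempty_hessianFrame x).some
  exact ⟨ParabolicSphere.isIntegrable_of_forall_exists_isHolomorphicChart fun x ↦
    (H x).exists_isHolomorphicChart J h.parallel,
    funext fun x ↦ (H x).torsion_conjConnection J h.parallel (H x).mem_domain⟩
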